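/- Let $(R,\le)$ be a totally ordered set and $\mathbf{k}$ a field. An \emph{interval} in $R$ is a non-empty subset $I\subseteq R$ such that $s\le u\le t$ with $s,t\in I$ implies $u\in I$; it is \emph{left separable} if there is a countable subset $S\subseteq I$ such that for every $t\in I$ there is $s\in S$ with $s\le t$. A \emph{persistence module} $V$ over $R$ is a functor from $R$ to $\mathbf{k}$-vector spaces, i.e. vector spaces $V_t$ ($t\in R$) and linear maps $\rho_{ts}:V_s\to V_t$ ($s\le t$) with $\rho_{tt}=1$ and $\rho_{ts}=\rho_{tu}\rho_{us}$ for $s\le u\le t$. The \emph{interval module} $\mathbf{k}_I$ of an interval $I$ has $(\mathbf{k}_I)_t=\mathbf{k}$ for $t\in I$, $(\mathbf{k}_I)_t=0$ for $t\notin I$, and $\rho_{ts}=1$ for $s\le t$ in $I$. Direct sums of persistence modules are formed pointwise. We say that $V$ has 1. the \emph{descending chain condition on images} if for all $t\ge s_1>s_2>\cdots$ in $R$ the chain $V_t\supseteq \operatorname{Im}(\rho_{ts_1})\supseteq \operatorname{Im}(\rho_{ts_2})\supseteq\cdots$ stabilizes; 2. the \emph{descending chain condition on sufficient bounded kernels}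 if for all $t\in R$ and $0\ne v\in V_t$ there is $s\le t$ with $v\in\operatorname{Im}(\rho_{ts})$ such that for all $r_1>r_2>\cdots$ in $R$ with every $r_n>t$ the chain $V_s\supseteq\operatorname{Ker}(\rho_{r_1s})\supseteq\operatorname{Ker}(\rho_{r_2s})\supseteq\cdots$ stabilizes. **Theorem.** Suppose that every interval in $R$ is left separable. Then every persistence module over $R$ that has the descending chain condition on images and on sufficient bounded kernels is isomorphic to a direct sum of interval modules. -/

import Mathlib

open CategoryTheory

universe u v w w'

/-- An interval in `R`: a non-empty order-convex subset. It need not have endpoints in `R`. -/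
structure OrderInterval (R : Type u) [LinearOrder R] where
  carrier : Set R
  nonempty : carrier.Nonempty
  ordConnected : carrier.OrdConnected

/-- An interval is left separable if it has a countable coinitial subset. -/
def OrderInterval.LeftSeparable {R : Type u} [LinearOrder R] (I : OrderInterval R) : Prop :=
  ∃ S : Set R, S.Countable ∧ S ⊆ I.carrier ∧ ∀ t ∈ I.carrier, ∃ s ∈ S, s ≤ t

/-- A persistence module over `R`: a functor from the ordered set `R` to `k`-vector spaces. -/
abbrev PersistenceModule (k : Type v) [Field k] (R : Type u) [LinearOrder R] :
    Type (max u v (w + 1)) :=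
  R ⥤ ModuleCat.{w} k

namespace PersistenceModule

variable {k : Type v} [Field k] {R : Type u} [LinearOrder R]

/-- The structure map `V_s → V_t` for `s ≤ t`. -/
def structureMap (V : PersistenceModule.{u, v, w} k R) {s t : R} (h : s ≤ t) :
    V.obj s →ₗ[k] V.obj t :=
  (V.map (homOfLE h)).hom

/-- For all `t ≥ s₀ > s₁ > ⋯` the images of `V_{sₙ} → V_t` stabilize. -/
def DCCImages (V : PersistenceModule.{u, v, w} k R) : Prop :=
  ∀ (t : R) (s : ℕ → R) (hst : ∀ n, s n ≤ t), StrictAnti s →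
    ∃ N, ∀ n, N ≤ n →
      LinearMap.range (V.structureMap (hst n)) = LinearMap.range (V.structureMap (hst N))

/-- For all `r₀ > r₁ > ⋯ > t` (where `s ≤ t`) the kernels of `V_s → V_{rₙ}` stabilize. -/
def DCCBoundedKernels (V : PersistenceModule.{u, v, w} k R) {s t : R} (hst : s ≤ t) : Prop :=
  ∀ (r : ℕ → R) (htr : ∀ n, t < r n), StrictAnti r →
    ∃ N, ∀ n, N ≤ n →
      LinearMap.ker (V.structureMap (hst.trans (htr n).le)) =
        LinearMap.ker (V.structureMap (hst.trans (htr N).le))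

/-- Every non-zero `v ∈ V_t` lies in the image of some `V_s`, `s ≤ t`, such that `V_s` has the
descending chain condition on `t`-bounded kernels. -/
def DCCSufficientBoundedKernels (V : PersistenceModule.{u, v, w} k R) : Prop :=
  ∀ (t : R) (x : V.obj t), x ≠ 0 →
    ∃ (s : R) (hst : s ≤ t),
      x ∈ LinearMap.range (V.structureMap hst) ∧ V.DCCBoundedKernels hst

variable (k) in
open Classical in
/-- The value at `t` of the interval module of `I`, as a subspace of `k`. -/
noncomputable def intervalSpace (I : OrderInterval R) (t : R) :
    Submodule k k :=
  if t ∈ I.carrier then ⊤ else ⊥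

variable (k) in
open Classical in
/-- The structure map of the interval module of `I`: the identity of `k` if `s, t ∈ I`, and zero
otherwise (if `s ∉ I` then its source is zero). -/
noncomputable def intervalMap (I : OrderInterval R) (s t : R) :
    intervalSpace k I s →ₗ[k] intervalSpace k I t :=
  if h : t ∈ I.carrier then
    LinearMap.codRestrict (intervalSpace k I t) (intervalSpace k I s).subtype
      (fun x => by simp [intervalSpace, h])
  else 0

open Classical in
theorem coe_intervalMap (I : OrderInterval R) (s t : R) (x : intervalSpace k I s) :
    (intervalMap k I s t x : k) = if t ∈ I.carrier then (x : k) else 0 := by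
  by_cases h : t ∈ I.carrier
  · simp only [intervalMap, dif_pos h, if_pos h]
    rfl
  · simp [intervalMap, h]

theorem intervalSpace_eq_zero (I : OrderInterval R) {t : R} (h : t ∉ I.carrier)
    (x : intervalSpace k I t) : (x : k) = 0 := by
  simpa [intervalSpace, h] using x.2

variable (k) in
/-- The interval module of `I`. -/
noncomputable def intervalModule (I : OrderInterval R) : PersistenceModule.{u, v, v} k R where
  obj t := ModuleCat.of k (intervalSpace k I t)
  map {s t} _ := ModuleCat.ofHom (intervalMap k I s t)
  map_id t := by
    apply ModuleCat.hom_ext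
    refine LinearMap.ext fun x => Subtype.ext ?_
    change (intervalMap k I t t x : k) = x
    rw [coe_intervalMap]
    split_ifs with h
    · rfl
    · exact (intervalSpace_eq_zero I h x).symm
  map_comp {s r t} f g := by
    apply ModuleCat.hom_ext
    refine LinearMap.ext fun x => Subtype.ext ?_
    change (intervalMap k I s t x : k) = (intervalMap k I r t (intervalMap k I s r x) : k)
    rw [coe_intervalMap, coe_intervalMap, coe_intervalMap]
    split_ifs with ht hr
    · rfl
    · exact intervalSpace_eq_zero I
        (fun hs => hr (I.ordConnected.out hs ht ⟨leOfHom f, leOfHom g⟩)) x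
    · rfl

/-- The pointwise direct sum of a family of persistence modules. -/
noncomputable def directSum {ι : Type w'} (W : ι → PersistenceModule.{u, v, w} k R) :
    PersistenceModule.{u, v, max w' w} k R where
  obj t := ModuleCat.of k (DirectSum ι fun i => (W i).obj t)
  map {s t} f := ModuleCat.ofHom
    (DFinsupp.mapRange.linearMap fun i => ((W i).map f).hom)
  map_id t := by
    ext x
    simp
  map_comp f g := by
    apply ModuleCat.hom_ext
    simp only [ModuleCat.hom_ofHom, ModuleCat.hom_comp, Functor.map_comp]
    exact DFinsupp.mapRange.linearMap_comp _ _

/-- An isomorphism of persistence modules, possibly in different universes: linear isomorphisms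
`V_t ≃ W_t` that commute with the structure maps. -/
structure PersistenceIso (V : PersistenceModule.{u, v, w} k R) (W : PersistenceModule.{u, v, w'} k R) where
  equiv : ∀ t, V.obj t ≃ₗ[k] W.obj t
  comm : ∀ {s t : R} (h : s ≤ t) (x : V.obj s),
    equiv t (V.structureMap h x) = W.structureMap h (equiv s x)

end PersistenceModule

/-! For `t ∈ I`, the quotient of `vPlus I t` by `vMinus I t` counts the copies of `k_I` in `V`. It
does not depend on `t ∈ I`: structure maps lift elements of `vPlus` (`exists_mem_vPlus`, from the
chain condition on images) and reflect `vMinus` (`map_mem_vMinus_iff`). Left separability makes `I`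
coinitially a sequence, so each element of `vPlus` extends to a compatible family, a thread
(`exists_thread`). A complement of the threads in `vMinus` therefore evaluates, at every `t ∈ I`, to
a complement of `vMinus` in `vPlus`, and each of its basis vectors spans a copy of `k_I`.

These copies are independent because, in a vanishing sum, the terms of the last interval add up to
an element of `vMinus` (`sum_mem_vMinus_of_sum_eq_zero`). They span because a proper subspace `S` of
`V_t` would yield an interval with `vMinus ≤ S` but not `vPlus ≤ S`; both chain conditions serve to
build it (`eq_top_of_forall_vPlus_le`). -/

/-- A monotone function that stabilizes along strictly decreasing sequences attains a least value
on every non-empty set. -/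
theorem Monotone.exists_forall_le_of_stabilizes {α β : Type*} [LinearOrder α] [PartialOrder β]
    {f : α → β} (hf : Monotone f)
    (h : ∀ s : ℕ → α, StrictAnti s → ∃ N, ∀ n, N ≤ n → f (s n) = f (s N))
    {A : Set α} (hA : A.Nonempty) : ∃ a ∈ A, ∀ b ∈ A, f a ≤ f b := by
  by_contra! hcon
  obtain ⟨a₀, ha₀⟩ := hA
  choose g hgA hg using hcon
  let G : A → A := fun a => ⟨g a a.2, hgA a a.2⟩
  have hG : ∀ a : A, G a < a := fun a =>
    lt_of_not_ge fun hle => hg a a.2 (hf hle)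
  let s : ℕ → A := fun n => G^[n] ⟨a₀, ha₀⟩
  have hs : ∀ n, s (n + 1) = G (s n) := fun n => Function.iterate_succ_apply' G n _
  obtain ⟨N, hN⟩ := h (fun n => s n) (strictAnti_nat_of_succ_lt fun n => by
    rw [hs]; exact hG (s n))
  have h1 := hN (N + 1) N.le_succ
  simp only [hs] at h1
  exact hg (s N) (s N).2 h1.ge

/-! ### Intervals as pairs of cuts -/

namespace OrderInterval

variable {R : Type u} [LinearOrder R]

/-- The strict lower bounds of an interval. -/
def below (I : OrderInterval R) : LowerSet R where
  carrier := {s | ∀ i ∈ I.carrier, s < i}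
  lower' _ _ hba ha i hi := hba.trans_lt (ha i hi)

/-- The lower closure of an interval. -/
def closureBelow (I : OrderInterval R) : LowerSet R where
  carrier := {r | ∃ i ∈ I.carrier, r ≤ i}
  lower' _ _ hba := fun ⟨i, hi, hai⟩ => ⟨i, hi, hba.trans hai⟩

/-- Endpoints may be missing from `R`; these two lower sets replace them and determine the interval.
-/
theorem mem_iff {I : OrderInterval R} {t : R} :
    t ∈ I.carrier ↔ t ∉ I.below ∧ t ∈ I.closureBelow := by
  refine ⟨fun h => ⟨fun h' => lt_irrefl _ (h' t h), t, h, le_rfl⟩, ?_⟩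
  rintro ⟨h, j, hj, htj⟩
  have h' : ¬ ∀ i ∈ I.carrier, t < i := h
  push Not at h'
  obtain ⟨i, hi, hit⟩ := h'
  exact I.ordConnected.out hi hj ⟨hit, htj⟩

/-- The position of an interval: first by its lower end, then by its upper end. -/
noncomputable def position (I : OrderInterval R) : Lex (LowerSet R × LowerSet R) :=
  toLex (I.below, I.closureBelow)

theorem position_injective : Function.Injective (position (R := R)) := by
  intro I J h
  have h1 : I.below = J.below := congrArg (fun p => (ofLex p).1) h
  have h2 : I.closureBelow = J.closureBelow := congrArg (fun p => (ofLex p).2) h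
  have : I.carrier = J.carrier := by
    ext t
    rw [mem_iff, mem_iff, h1, h2]
  cases I; cases J; congr

/-- A left separable interval has a coinitial decreasing sequence starting at any of its points. -/
theorem LeftSeparable.exists_antitone {I : OrderInterval R} (hI : I.LeftSeparable) {t : R}
    (ht : t ∈ I.carrier) :
    ∃ a : ℕ → R, a 0 = t ∧ (∀ n, a n ∈ I.carrier) ∧ (∀ n, a (n + 1) ≤ a n) ∧
      ∀ r ∈ I.carrier, ∃ n, a n ≤ r := by
  obtain ⟨S, hS, hSI, hco⟩ := hI
  obtain ⟨s₀, hs₀, -⟩ := hco t ht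
  obtain ⟨e, rfl⟩ := hS.exists_eq_range ⟨s₀, hs₀⟩
  -- Running minimum of `t` and an enumeration of `S`. It may repeat values, hence only weak
  -- decrease.
  let a : ℕ → R := fun n => Nat.rec t (fun n x => min x (e n)) n
  refine ⟨a, rfl, fun n => ?_, fun n => min_le_left _ _, fun r hr => ?_⟩
  · induction n with
    | zero => exact ht
    | succ n ih =>
      change min (a n) (e n) ∈ I.carrier
      rcases min_choice (a n) (e n) with h | h <;> rw [h]
      exacts [ih, hSI ⟨n, rfl⟩]
  · obtain ⟨_, ⟨n, rfl⟩, hn⟩ := hco r hr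
    exact ⟨n + 1, (min_le_right _ _).trans hn⟩

end OrderInterval

/-! ### Least images and kernels -/

namespace PersistenceModule

variable {k : Type v} [Field k] {R : Type u} [LinearOrder R] (V : PersistenceModule.{u, v, w} k R)

@[simp]
theorem structureMap_refl {t : R} (x : V.obj t) : V.structureMap le_rfl x = x := by
  simp [structureMap]

@[simp]
theorem structureMap_structureMap {s r t : R} (h₁ : s ≤ r) (h₂ : r ≤ t) (x : V.obj s) :
    V.structureMap h₂ (V.structureMap h₁ x) = V.structureMap (h₁.trans h₂) x := by
  have : V.map (homOfLE (h₁.trans h₂)) = V.map (homOfLE h₁) ≫ V.map (homOfLE h₂) := by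
    rw [← V.map_comp]; rfl
  simp [structureMap, this]

theorem range_structureMap_mono {s s' t : R} (h : s ≤ s') (h' : s' ≤ t) :
    LinearMap.range (V.structureMap (h.trans h')) ≤ LinearMap.range (V.structureMap h') := by
  rintro _ ⟨z, rfl⟩
  exact ⟨V.structureMap h z, by simp⟩

theorem ker_structureMap_mono {t r r' : R} (h : t ≤ r) (h' : r ≤ r') :
    LinearMap.ker (V.structureMap h) ≤ LinearMap.ker (V.structureMap (h.trans h')) := by
  intro x hx
  rw [LinearMap.mem_ker] at hx ⊢
  rw [← V.structureMap_structureMap h h', hx, map_zero]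

theorem DCCImages.exists_least {V : PersistenceModule.{u, v, w} k R} (hV : V.DCCImages) {t : R}
    {A : Set (Set.Iic t)} (hA : A.Nonempty) :
    ∃ a ∈ A, ∀ b ∈ A,
      LinearMap.range (V.structureMap a.2) ≤ LinearMap.range (V.structureMap b.2) :=
  Monotone.exists_forall_le_of_stabilizes
    (f := fun a : Set.Iic t => LinearMap.range (V.structureMap a.2))
    (fun _ b hab => V.range_structureMap_mono hab b.2)
    (fun s hs => hV t (fun n => s n) (fun n => (s n).2) fun _ _ h => hs h) hA

/-- The hypothesis concerns kernels inside `V_s`. It passes to `X ⊆ V_t` because each element of `X`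
is the image of some `z ∈ V_s`, and it dies at `r` exactly when `z` does. -/
theorem DCCBoundedKernels.exists_least {V : PersistenceModule.{u, v, w} k R} {s t : R}
    {hst : s ≤ t} (hV : V.DCCBoundedKernels hst) {X : Submodule k (V.obj t)}
    (hX : X ≤ LinearMap.range (V.structureMap hst)) {A : Set (Set.Ioi t)} (hA : A.Nonempty) :
    ∃ a ∈ A, ∀ b ∈ A, X ⊓ LinearMap.ker (V.structureMap (Set.mem_Ioi.1 a.2).le) ≤
      X ⊓ LinearMap.ker (V.structureMap (Set.mem_Ioi.1 b.2).le) := by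
  refine Monotone.exists_forall_le_of_stabilizes
    (f := fun a : Set.Ioi t => X ⊓ LinearMap.ker (V.structureMap (Set.mem_Ioi.1 a.2).le))
    (fun a _ hab => inf_le_inf le_rfl (V.ker_structureMap_mono (Set.mem_Ioi.1 a.2).le hab))
    (fun r hr => ?_) hA
  obtain ⟨N, hN⟩ := hV (fun n => r n) (fun n => (r n).2) fun _ _ h => hr h
  refine ⟨N, fun n hn => ?_⟩
  ext x
  simp only [Submodule.mem_inf, LinearMap.mem_ker]
  refine and_congr_right fun hx => ?_
  obtain ⟨z, rfl⟩ := hX hx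
  have := SetLike.ext_iff.1 (hN n hn) z
  simpa only [LinearMap.mem_ker, structureMap_structureMap] using this

/-! ### Image and kernel filtrations attached to an interval -/

/-- The elements of `V_t` that come from all points of `I` before `t`. -/
def imPlus (I : OrderInterval R) (t : R) : Submodule k (V.obj t) :=
  ⨅ (s : R) (_ : s ∈ I.carrier) (h : s ≤ t), LinearMap.range (V.structureMap h)

/-- The elements of `V_t` that come from some point before `t` outside `I`. -/
def imMinus (I : OrderInterval R) (t : R) : Submodule k (V.obj t) where
  -- Zero is added by hand: there may be no point outside `I` before `t`.
  carrier := {x | x = 0 ∨ ∃ s, s ∉ I.carrier ∧ ∃ h : s ≤ t, x ∈ LinearMap.range (V.structureMap h)}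
  zero_mem' := Or.inl rfl
  add_mem' := by
    rintro x y (rfl | ⟨s, hs, hst, hx⟩) (rfl | ⟨s', hs', hst', hy⟩)
    · exact Or.inl (add_zero 0)
    · exact Or.inr ⟨s', hs', hst', by simpa using hy⟩
    · exact Or.inr ⟨s, hs, hst, by simpa using hx⟩
    · rcases le_total s s' with h | h
      · exact Or.inr ⟨s', hs', hst', add_mem (V.range_structureMap_mono h hst' hx) hy⟩
      · exact Or.inr ⟨s, hs, hst, add_mem hx (V.range_structureMap_mono h hst hy)⟩
  smul_mem' := by
    rintro c x (rfl | ⟨s, hs, hst, hx⟩)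
    · exact Or.inl (smul_zero c)
    · exact Or.inr ⟨s, hs, hst, Submodule.smul_mem _ c hx⟩

/-- The elements of `V_t` that vanish at all points after `t` outside `I`. -/
def kerPlus (I : OrderInterval R) (t : R) : Submodule k (V.obj t) :=
  ⨅ (r : R) (_ : r ∉ I.carrier) (h : t ≤ r), LinearMap.ker (V.structureMap h)

/-- The elements of `V_t` that vanish at some point of `I` after `t`. -/
def kerMinus (I : OrderInterval R) (t : R) : Submodule k (V.obj t) where
  carrier := {x | x = 0 ∨ ∃ r ∈ I.carrier, ∃ h : t ≤ r, x ∈ LinearMap.ker (V.structureMap h)}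
  zero_mem' := Or.inl rfl
  add_mem' := by
    rintro x y (rfl | ⟨s, hs, hst, hx⟩) (rfl | ⟨s', hs', hst', hy⟩)
    · exact Or.inl (add_zero 0)
    · exact Or.inr ⟨s', hs', hst', by simpa using hy⟩
    · exact Or.inr ⟨s, hs, hst, by simpa using hx⟩
    · rcases le_total s s' with h | h
      · exact Or.inr ⟨s', hs', hst', add_mem (V.ker_structureMap_mono hst h hx) hy⟩
      · exact Or.inr ⟨s, hs, hst, add_mem hx (V.ker_structureMap_mono hst' h hy)⟩
  smul_mem' := by
    rintro c x (rfl | ⟨s, hs, hst, hx⟩)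
    · exact Or.inl (smul_zero c)
    · exact Or.inr ⟨s, hs, hst, Submodule.smul_mem _ c hx⟩

/-- The part of `V_t` whose life contains `I`, from its lower end on, and ends with it at the
latest. -/
def vPlus (I : OrderInterval R) (t : R) : Submodule k (V.obj t) :=
  V.imPlus I t ⊓ V.kerPlus I t

/-- The part of `vPlus` that is born before `I` or dies in `I`. -/
def vMinus (I : OrderInterval R) (t : R) : Submodule k (V.obj t) :=
  (V.imMinus I t ⊓ V.kerPlus I t) ⊔ (V.imPlus I t ⊓ V.kerMinus I t)

variable {V} {I : OrderInterval R} {s t : R}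

theorem mem_imPlus {x : V.obj t} : x ∈ V.imPlus I t ↔
    ∀ s ∈ I.carrier, ∀ h : s ≤ t, x ∈ LinearMap.range (V.structureMap h) := by
  simp only [imPlus, Submodule.mem_iInf]

theorem mem_imMinus {x : V.obj t} : x ∈ V.imMinus I t ↔
    x = 0 ∨ ∃ s, s ∉ I.carrier ∧ ∃ h : s ≤ t, x ∈ LinearMap.range (V.structureMap h) :=
  Iff.rfl

theorem mem_kerPlus {x : V.obj t} : x ∈ V.kerPlus I t ↔
    ∀ r, r ∉ I.carrier → ∀ h : t ≤ r, V.structureMap h x = 0 := by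
  simp only [kerPlus, Submodule.mem_iInf, LinearMap.mem_ker]

theorem mem_kerMinus {x : V.obj t} : x ∈ V.kerMinus I t ↔
    x = 0 ∨ ∃ r ∈ I.carrier, ∃ h : t ≤ r, V.structureMap h x = 0 :=
  Iff.rfl

theorem kerMinus_le_kerPlus (ht : t ∈ I.carrier) : V.kerMinus I t ≤ V.kerPlus I t := by
  intro x hx
  refine mem_kerPlus.2 fun r hr htr => ?_
  rcases mem_kerMinus.1 hx with rfl | ⟨q, hq, htq, hx⟩
  · exact map_zero _
  · have hqr : q ≤ r := le_of_not_ge fun h => hr (I.ordConnected.out ht hq ⟨htr, h⟩)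
    rw [← V.structureMap_structureMap htq hqr, hx, map_zero]

theorem map_mem_imPlus (h : s ≤ t) {y : V.obj s} (hy : y ∈ V.imPlus I s) :
    V.structureMap h y ∈ V.imPlus I t := by
  refine mem_imPlus.2 fun q hq hqt => ?_
  rcases le_total q s with hqs | hsq
  · obtain ⟨z, rfl⟩ := mem_imPlus.1 hy q hq hqs
    exact ⟨z, by simp⟩
  · exact ⟨V.structureMap hsq y, by simp⟩

theorem map_mem_imMinus (h : s ≤ t) {y : V.obj s} (hy : y ∈ V.imMinus I s) :
    V.structureMap h y ∈ V.imMinus I t := by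
  rcases mem_imMinus.1 hy with rfl | ⟨q, hq, hqs, z, rfl⟩
  · simp
  · exact mem_imMinus.2 (Or.inr ⟨q, hq, hqs.trans h, z, by simp⟩)

/-- By convexity of `I`, every point outside `I` after `s` is also after `t`, so both sides test
vanishing at the same points. -/
theorem map_mem_kerPlus_iff (hs : s ∈ I.carrier) (ht : t ∈ I.carrier) (h : s ≤ t) {y : V.obj s} :
    V.structureMap h y ∈ V.kerPlus I t ↔ y ∈ V.kerPlus I s := by
  simp only [mem_kerPlus, structureMap_structureMap]
  refine ⟨fun hy r hr hsr => ?_, fun hy r hr htr => hy r hr _⟩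
  exact hy r hr (le_of_not_ge fun hrt => hr (I.ordConnected.out hs ht ⟨hsr, hrt⟩))

theorem map_mem_kerMinus_iff (ht : t ∈ I.carrier) (h : s ≤ t)
    {y : V.obj s} : V.structureMap h y ∈ V.kerMinus I t ↔ y ∈ V.kerMinus I s := by
  simp only [mem_kerMinus, structureMap_structureMap]
  constructor
  · rintro (hy | ⟨r, hr, htr, hy⟩)
    exacts [Or.inr ⟨t, ht, h, hy⟩, Or.inr ⟨r, hr, _, hy⟩]
  · rintro (rfl | ⟨r, hr, hsr, hy⟩)
    · exact Or.inl (map_zero _)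
    · rcases le_total r t with hrt | htr
      · exact Or.inl (by rw [← V.structureMap_structureMap hsr hrt, hy, map_zero])
      · exact Or.inr ⟨r, hr, htr, hy⟩

/-- Among the points of `I` up to `s`, some `q` has the least image in `V_s`. Lifting `x` to `V_q`
and pushing the lift to `V_s` gives an element of all these images at once. -/
theorem exists_mem_imPlus (hV : V.DCCImages) (hs : s ∈ I.carrier) (h : s ≤ t) {x : V.obj t}
    (hx : x ∈ V.imPlus I t) : ∃ y ∈ V.imPlus I s, V.structureMap h y = x := by
  obtain ⟨⟨q, (hqs : q ≤ s)⟩, hq, hmin⟩ := hV.exists_least (t := s) (A := {q | (q : R) ∈ I.carrier})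
    ⟨⟨s, le_rfl⟩, hs⟩
  obtain ⟨z, rfl⟩ := mem_imPlus.1 hx q hq (le_trans hqs h)
  exact ⟨V.structureMap hqs z, mem_imPlus.2 fun q' hq' hqs' => hmin ⟨q', hqs'⟩ hq' ⟨z, rfl⟩,
    by simp⟩

theorem exists_mem_imMinus (hs : s ∈ I.carrier) (ht : t ∈ I.carrier) (h : s ≤ t) {x : V.obj t}
    (hx : x ∈ V.imMinus I t) : ∃ y ∈ V.imMinus I s, V.structureMap h y = x := by
  rcases mem_imMinus.1 hx with rfl | ⟨q, hq, hqt, z, rfl⟩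
  · exact ⟨0, zero_mem _, map_zero _⟩
  · have hqs : q ≤ s := le_of_not_ge fun hsq => hq (I.ordConnected.out hs ht ⟨hsq, hqt⟩)
    exact ⟨V.structureMap hqs z, mem_imMinus.2 (Or.inr ⟨q, hq, hqs, z, rfl⟩), by simp⟩

theorem exists_mem_vPlus (hV : V.DCCImages) (hs : s ∈ I.carrier) (ht : t ∈ I.carrier) (h : s ≤ t)
    {x : V.obj t} (hx : x ∈ V.vPlus I t) : ∃ y ∈ V.vPlus I s, V.structureMap h y = x := by
  obtain ⟨y, hy, rfl⟩ := exists_mem_imPlus hV hs h hx.1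
  exact ⟨y, ⟨hy, (map_mem_kerPlus_iff hs ht h).1 hx.2⟩, rfl⟩

theorem map_mem_vPlus (hs : s ∈ I.carrier) (ht : t ∈ I.carrier) (h : s ≤ t) {y : V.obj s}
    (hy : y ∈ V.vPlus I s) : V.structureMap h y ∈ V.vPlus I t :=
  ⟨map_mem_imPlus h hy.1, (map_mem_kerPlus_iff hs ht h).2 hy.2⟩

/-- Together with `exists_mem_vPlus`, this makes `vPlus / vMinus` constant along `I`. -/
theorem map_mem_vMinus_iff (hV : V.DCCImages) (hs : s ∈ I.carrier) (ht : t ∈ I.carrier)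
    (h : s ≤ t) {y : V.obj s} (hy : y ∈ V.vPlus I s) :
    V.structureMap h y ∈ V.vMinus I t ↔ y ∈ V.vMinus I s := by
  simp only [vMinus, Submodule.mem_sup]
  constructor
  · rintro ⟨a, ⟨ha, ha'⟩, b, ⟨hb, hb'⟩, hab⟩
    obtain ⟨a, haI, rfl⟩ := exists_mem_imMinus hs ht h ha
    obtain ⟨b, -, rfl⟩ := exists_mem_imPlus hV hs h hb
    replace ha' := (map_mem_kerPlus_iff hs ht h).1 ha'
    replace hb' := (map_mem_kerMinus_iff ht h).1 hb'
    -- The lifts satisfy `y = a + b` only after mapping to `V_t`, so `y - a` rather than `b` serves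
    -- as the second summand.
    have hc : y - a ∈ V.kerMinus I s := by
      rw [← map_mem_kerMinus_iff ht h, map_sub, ← hab, add_sub_cancel_left]
      exact (map_mem_kerMinus_iff ht h).2 hb'
    refine ⟨a, ⟨haI, ha'⟩, y - a, ⟨?_, hc⟩, by abel⟩
    have haP : a ∈ V.imPlus I s := by
      rcases mem_imMinus.1 haI with rfl | ⟨q, hq, hqs, hz⟩
      · exact zero_mem _
      · refine mem_imPlus.2 fun q' hq' hqs' => V.range_structureMap_mono ?_ hqs' hz
        exact le_of_not_ge fun hle => hq (I.ordConnected.out hq' hs ⟨hle, hqs⟩)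
    exact sub_mem hy.1 haP
  · rintro ⟨a, ⟨ha, ha'⟩, b, ⟨hb, hb'⟩, rfl⟩
    exact ⟨_, ⟨map_mem_imMinus h ha, (map_mem_kerPlus_iff hs ht h).2 ha'⟩, _,
      ⟨map_mem_imPlus h hb, (map_mem_kerMinus_iff ht h).2 hb'⟩, (map_add _ _ _).symm⟩

/-! ### Spanning -/

/-- A subspace of `V_t` that contains a complement of `vMinus` in `vPlus` for every interval is the
whole of `V_t`. -/
theorem eq_top_of_forall_vPlus_le (hIm : V.DCCImages) (hKer : V.DCCSufficientBoundedKernels)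
    {S : Submodule k (V.obj t)}
    (hS : ∀ I : OrderInterval R, t ∈ I.carrier → V.vPlus I t ≤ V.vMinus I t ⊔ S) : S = ⊤ := by
  by_contra hne
  let A : Set (Set.Iic t) := {q | ¬ LinearMap.range (V.structureMap q.2) ≤ S}
  have htA : (⟨t, le_rfl⟩ : Set.Iic t) ∈ A := fun h =>
    hne (top_unique fun x _ => h ⟨x, by simp⟩)
  obtain ⟨a, haA, hamin⟩ := hIm.exists_least (A := A) ⟨_, htA⟩
  set X := LinearMap.range (V.structureMap a.2) with hX
  obtain ⟨x, hxX, hxS⟩ := Set.not_subset.1 haA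
  obtain ⟨s, hst, hxs, hs⟩ := hKer t x fun h => hxS (h ▸ zero_mem S)
  -- The image from `s` contains `x ∉ S`, so minimality of `X` puts `X` inside it; this makes the
  -- kernel condition at `s` available for `X`.
  by_cases hXs : X ≤ LinearMap.range (V.structureMap hst)
  swap
  · refine hXs (hamin ⟨s, hst⟩ fun h => hxS (h hxs))
  let B : Set (Set.Ioi t) :=
    {r | ¬ X ⊓ LinearMap.ker (V.structureMap (Set.mem_Ioi.1 r.2).le) ≤ S}
  -- `Y` is the least `X ⊓ ker` not inside `S`, or `X` itself if all of them are inside `S`.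
  obtain ⟨Y, hYX, hYS, hYB⟩ : ∃ Y ≤ X, ¬ Y ≤ S ∧ ∀ r ∈ B,
      Y ≤ LinearMap.ker (V.structureMap (Set.mem_Ioi.1 r.2).le) := by
    rcases B.eq_empty_or_nonempty with hB | hB
    · exact ⟨X, le_rfl, haA, by simp [hB]⟩
    · obtain ⟨b, hb, hbmin⟩ := hs.exists_least hXs hB
      exact ⟨_, inf_le_left, hb, fun r hr => (hbmin r hr).trans inf_le_right⟩
  -- Before `t`, the interval starts where images escape `S`; after `t`, it lasts as long as the
  -- part of `X` already dead lies in `S`. Then `Y ≤ vPlus` and `vMinus ≤ S`, which contradicts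
  -- `hYS`.
  let I : OrderInterval R :=
    { carrier := {q | (∀ h : q ≤ t, ⟨q, h⟩ ∈ A) ∧ ∀ h : t < q, ⟨q, h⟩ ∉ B}
      nonempty := ⟨t, fun _ => htA, fun h => absurd h (lt_irrefl t)⟩
      ordConnected := by
        refine ⟨fun p hp q hq r hr => ⟨fun h hle => ?_, fun h hle => ?_⟩⟩
        · exact hp.1 (hr.1.trans h) ((V.range_structureMap_mono hr.1 h).trans hle)
        · exact hq.2 (h.trans_le hr.2) fun hle' => hle
            ((inf_le_inf le_rfl (V.ker_structureMap_mono h.le hr.2)).trans hle') }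
  have htI : t ∈ I.carrier := ⟨fun _ => htA, fun h => absurd h (lt_irrefl t)⟩
  have hbelow : ∀ q, ∀ h : q ≤ t, q ∉ I.carrier → LinearMap.range (V.structureMap h) ≤ S := by
    intro q h hq
    by_contra hcon
    exact hq ⟨fun _ => hcon, fun h' => absurd h h'.not_ge⟩
  have habove : ∀ r, t ≤ r → r ∉ I.carrier → ∃ h : t < r, ⟨r, h⟩ ∈ B := by
    intro r h hr
    rcases h.eq_or_lt with rfl | h
    · exact absurd htI hr
    · refine ⟨h, ?_⟩
      by_contra hcon
      exact hr ⟨fun h' => absurd h h'.not_gt, fun _ => hcon⟩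
  have hX_eq : V.imPlus I t ≤ X := fun y hy => mem_imPlus.1 hy a
    ⟨fun _ => haA, fun h => absurd h (not_lt.2 a.2)⟩ a.2
  refine hYS ((le_inf (hYX.trans fun y hy => ?_) fun y hy => ?_).trans
    ((hS I htI).trans (sup_le (sup_le ?_ ?_) le_rfl)))
  · exact mem_imPlus.2 fun q hq hqt => hamin ⟨q, hqt⟩ (hq.1 hqt) hy
  · refine mem_kerPlus.2 fun r hr htr => ?_
    obtain ⟨h, hB⟩ := habove r htr hr
    exact hYB _ hB hy
  · rintro y ⟨hy, -⟩
    rcases mem_imMinus.1 hy with rfl | ⟨q, hq, hqt, hy⟩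
    exacts [zero_mem S, hbelow q hqt hq hy]
  · rintro y ⟨hy, hy'⟩
    rcases mem_kerMinus.1 hy' with rfl | ⟨r, hr, htr, hy'⟩
    · exact zero_mem S
    · rcases htr.eq_or_lt with rfl | h
      · rw [structureMap_refl] at hy'
        exact hy' ▸ zero_mem S
      · by_contra hyS
        exact hr.2 h fun hle => hyS (hle ⟨hX_eq hy, hy'⟩)

/-! ### Comparison of different intervals -/

/-- Since `I` starts earlier, a point `i` of `I` lies at or before some `q` strictly below `J`;
elements coming from `i` also come from `q`. -/
theorem imPlus_le_imMinus {I J : OrderInterval R} (hJ : t ∈ J.carrier)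
    (h : I.below < J.below) : V.imPlus I t ≤ V.imMinus J t := by
  obtain ⟨q, hqJ, hqI⟩ := Set.exists_of_ssubset (show (I.below : Set R) ⊂ J.below from h)
  have hqI' : ¬ ∀ i ∈ I.carrier, q < i := hqI
  push Not at hqI'
  obtain ⟨i, hi, hiq⟩ := hqI'
  have hqt : q < t := hqJ t hJ
  intro x hx
  exact mem_imMinus.2 (Or.inr ⟨q, fun hq => lt_irrefl q (hqJ q hq), hqt.le,
    V.range_structureMap_mono hiq hqt.le (mem_imPlus.1 hx i hi _)⟩)

theorem imPlus_le_imPlus {I J : OrderInterval R} (hI : t ∈ I.carrier)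
    (h : I.below = J.below) : V.imPlus I t ≤ V.imPlus J t := by
  refine fun x hx => mem_imPlus.2 fun q hq hqt => mem_imPlus.1 hx q ?_ hqt
  exact OrderInterval.mem_iff.2 ⟨h ▸ (OrderInterval.mem_iff.1 hq).1, t, hI, hqt⟩

/-- Since `J` ends later, it contains a point `r ≥ t` beyond all of `I`, where `kerPlus I t`
vanishes. -/
theorem kerPlus_le_kerMinus {I J : OrderInterval R} (hI : t ∈ I.carrier) (hJ : t ∈ J.carrier)
    (h : I.closureBelow < J.closureBelow) : V.kerPlus I t ≤ V.kerMinus J t := by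
  obtain ⟨r, ⟨j, hj, hrj⟩, hrI⟩ :=
    Set.exists_of_ssubset (show (I.closureBelow : Set R) ⊂ J.closureBelow from h)
  have htr : t ≤ r := le_of_not_ge fun hrt => hrI ⟨t, hI, hrt⟩
  intro x hx
  exact mem_kerMinus.2 (Or.inr ⟨r, J.ordConnected.out hJ hj ⟨htr, hrj⟩, htr,
    mem_kerPlus.1 hx r (fun hr => hrI ⟨r, hr, le_rfl⟩) htr⟩)

/-- In a vanishing sum of elements of `vPlus`, the part of the last interval lies in `vMinus`. -/
theorem sum_mem_vMinus_of_sum_eq_zero {ι : Type*} [DecidableEq (OrderInterval R)] {F : Finset ι}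
    {f : ι → OrderInterval R} (hF : ∀ i ∈ F, t ∈ (f i).carrier) {x : ι → V.obj t}
    (hx : ∀ i ∈ F, x i ∈ V.vPlus (f i) t) (hsum : ∑ i ∈ F, x i = 0) (ht : t ∈ I.carrier)
    (hmax : ∀ i ∈ F, (f i).position ≤ I.position) :
    ∑ i ∈ F with f i = I, x i ∈ V.vMinus I t := by
  classical
  -- Three groups: the interval `I` itself (`y`), intervals starting earlier (`a`), and intervals
  -- with the same start ending earlier (`b`).
  rw [← Finset.sum_filter_add_sum_filter_not F fun i => f i = I,
    ← Finset.sum_filter_add_sum_filter_not (F.filter fun i => ¬ f i = I)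
      fun i => (f i).below < I.below] at hsum
  have hxI : ∑ i ∈ F with f i = I, x i ∈ V.vPlus I t := by
    refine sum_mem fun i hi => ?_
    obtain ⟨hiF, rfl⟩ := Finset.mem_filter.1 hi
    exact hx i hiF
  set y := ∑ i ∈ F with f i = I, x i
  set a := ∑ i ∈ F.filter (fun i => ¬ f i = I) with (f i).below < I.below, x i
  set b := ∑ i ∈ F.filter (fun i => ¬ f i = I) with ¬ (f i).below < I.below, x i
  have ha' : a ∈ V.imMinus I t := by
    refine sum_mem fun i hi => ?_
    simp only [Finset.mem_filter] at hi
    exact imPlus_le_imMinus ht hi.2 (hx i hi.1.1).1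
  have hb' : b ∈ V.imPlus I t ⊓ V.kerMinus I t := by
    refine sum_mem fun i hi => ?_
    simp only [Finset.mem_filter] at hi
    obtain ⟨⟨hi, hne⟩, hlt⟩ := hi
    have hle : (f i).position < I.position :=
      lt_of_le_of_ne (hmax i hi) fun h => hne (OrderInterval.position_injective h)
    rcases Prod.Lex.toLex_lt_toLex.1 hle with h | ⟨h, h'⟩
    · exact absurd h hlt
    · exact ⟨imPlus_le_imPlus (hF i hi) h (hx i hi).1,
        kerPlus_le_kerMinus (hF i hi) ht h' (hx i hi).2⟩
  have hsum' : y = -a + -b := by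
    rw [← neg_add]; exact eq_neg_of_add_eq_zero_left hsum
  -- Intervals starting earlier may end after `I`, so single terms of `a` can survive `I`; only the
  -- relation `y + a + b = 0` forces their sum into `kerPlus`.
  have ha'' : a ∈ V.kerPlus I t := by
    have : a = -(y + b) := by rw [hsum']; abel
    rw [this]
    exact neg_mem (add_mem hxI.2 (kerMinus_le_kerPlus ht hb'.2))
  rw [hsum']
  exact Submodule.add_mem_sup (neg_mem ⟨ha', ha''⟩) (neg_mem hb')

end PersistenceModule

/-! ### Threads over an interval -/

namespace PersistenceModule

variable {k : Type v} [Field k] {R : Type u} [LinearOrder R] (V : PersistenceModule.{u, v, w} k R)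

/-- The compatible families over `I` of elements of `vPlus`, extended by zero. -/
def threads (I : OrderInterval R) : Submodule k (∀ t, V.obj t) where
  carrier := {x | (∀ t ∈ I.carrier, x t ∈ V.vPlus I t) ∧ (∀ t, t ∉ I.carrier → x t = 0) ∧
    ∀ s ∈ I.carrier, ∀ t ∈ I.carrier, ∀ h : s ≤ t, V.structureMap h (x s) = x t}
  zero_mem' := ⟨fun _ _ => zero_mem _, fun _ _ => rfl, fun _ _ _ _ _ => map_zero _⟩
  add_mem' := fun hx hy => ⟨fun t ht => add_mem (hx.1 t ht) (hy.1 t ht),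
    fun t ht => by simp [hx.2.1 t ht, hy.2.1 t ht],
    fun s hs t ht h => by simp [hx.2.2 s hs t ht h, hy.2.2 s hs t ht h]⟩
  smul_mem' := fun c _ hx => ⟨fun t ht => Submodule.smul_mem _ c (hx.1 t ht),
    fun t ht => by simp [hx.2.1 t ht], fun s hs t ht h => by simp [hx.2.2 s hs t ht h]⟩

/-- The compatible families of elements of `vMinus`. -/
def threadsMinus (I : OrderInterval R) : Submodule k (V.threads I) where
  carrier := {x | ∀ t ∈ I.carrier, (x : ∀ t, V.obj t) t ∈ V.vMinus I t}
  zero_mem' := fun _ _ => zero_mem _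
  add_mem' := fun hx hy t ht => add_mem (hx t ht) (hy t ht)
  smul_mem' := fun c _ hx t ht => Submodule.smul_mem _ c (hx t ht)

/-- A chosen complement of `threadsMinus` in `threads`. -/
noncomputable def threadsCompl (I : OrderInterval R) : Submodule k (V.threads I) :=
  (V.threadsMinus I).exists_isCompl.choose

theorem isCompl_threadsCompl (I : OrderInterval R) :
    IsCompl (V.threadsMinus I) (V.threadsCompl I) :=
  (V.threadsMinus I).exists_isCompl.choose_spec

variable {V} {I : OrderInterval R} {s t : R}

/-- Beyond `I` the extension by zero is compatible because `x s` lies in `kerPlus`. Hence a thread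
is a map out of `k_I`. -/
theorem structureMap_thread {x : ∀ t, V.obj t} (hx : x ∈ V.threads I) (hs : s ∈ I.carrier)
    (h : s ≤ t) : V.structureMap h (x s) = x t := by
  by_cases ht : t ∈ I.carrier
  · exact hx.2.2 s hs t ht h
  · rw [hx.2.1 t ht]
    exact mem_kerPlus.1 (hx.1 s hs).2 t ht h

/-- A sequence coinitial in `I` and starting at `t` allows lifting `x` one step at a time; the value
at any other point of `I` is pushed forward from a term of the sequence below it. -/
theorem exists_thread (hV : V.DCCImages) (hI : I.LeftSeparable) (ht : t ∈ I.carrier)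
    {x : V.obj t} (hx : x ∈ V.vPlus I t) : ∃ y ∈ V.threads I, y t = x := by
  classical
  obtain ⟨a, rfl, haI, hsucc, hco⟩ := hI.exists_antitone ht
  have ha : Antitone a := antitone_nat_of_succ_le hsucc
  have hlift : ∀ n (y : V.vPlus I (a n)), ∃ z : V.vPlus I (a (n + 1)),
      V.structureMap (hsucc n) z = y := fun n y => by
    obtain ⟨z, hz, h⟩ := exists_mem_vPlus hV (haI (n + 1)) (haI n) (hsucc n) y.2
    exact ⟨⟨z, hz⟩, h⟩
  choose lift hlift using hlift
  let y : ∀ n, V.vPlus I (a n) := fun n => Nat.rec ⟨x, hx⟩ lift n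
  have hy : ∀ m n (h : m ≤ n), V.structureMap (ha h) (y n).1 = (y m).1 := by
    intro m n h
    induction n, h using Nat.le_induction with
    | base => exact V.structureMap_refl _
    | succ n h ih =>
      rw [← ih, ← hlift n (y n), structureMap_structureMap]
  choose N hN using hco
  let z : ∀ r, V.obj r := fun r => if h : r ∈ I.carrier then V.structureMap (hN r h) (y (N r h)).1
    else 0
  -- The value at `r` does not depend on the chosen term `N r`.
  have hz : ∀ r ∈ I.carrier, ∀ n (h : a n ≤ r), z r = V.structureMap h (y n).1 := by
    intro r hr n h
    simp only [z, dif_pos hr]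
    rcases le_total n (N r hr) with hle | hle
    · rw [← hy _ _ hle, structureMap_structureMap]
    · rw [← hy _ _ hle, structureMap_structureMap]
  refine ⟨z, ⟨fun r hr => ?_, fun r hr => dif_neg hr, fun r hr r' hr' h => ?_⟩, ?_⟩
  · rw [hz r hr _ (hN r hr)]
    exact map_mem_vPlus (haI _) hr _ (y _).2
  · rw [hz r hr _ (hN r hr), hz r' hr' _ ((hN r hr).trans h), structureMap_structureMap]
  · rw [hz _ ht 0 le_rfl, structureMap_refl]
    rfl

theorem mem_threadsMinus (hV : V.DCCImages) (ht : t ∈ I.carrier) {x : V.threads I}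
    (hx : (x : ∀ t, V.obj t) t ∈ V.vMinus I t) : x ∈ V.threadsMinus I := by
  intro r hr
  rcases le_total r t with h | h
  · rwa [← map_mem_vMinus_iff hV hr ht h (x.2.1 r hr), structureMap_thread x.2 hr h]
  · rw [← structureMap_thread x.2 ht h]
    exact (map_mem_vMinus_iff hV ht hr h (x.2.1 t ht)).2 hx

theorem eq_zero_of_mem_threadsCompl (hV : V.DCCImages) (ht : t ∈ I.carrier) {x : V.threads I}
    (hxC : x ∈ V.threadsCompl I) (hx : (x : ∀ t, V.obj t) t ∈ V.vMinus I t) : x = 0 :=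
  Submodule.disjoint_def.1 (V.isCompl_threadsCompl I).disjoint x (mem_threadsMinus hV ht hx) hxC

/-- With `eq_zero_of_mem_threadsCompl`, this says that evaluation at `t` carries `threadsCompl`
isomorphically onto a complement of `vMinus` in `vPlus`. -/
theorem exists_mem_threadsCompl (hV : V.DCCImages) (hI : I.LeftSeparable) (ht : t ∈ I.carrier)
    {x : V.obj t} (hx : x ∈ V.vPlus I t) :
    ∃ c ∈ V.threadsCompl I, x - (c : ∀ t, V.obj t) t ∈ V.vMinus I t := by
  obtain ⟨y, hy, rfl⟩ := exists_thread hV hI ht hx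
  obtain ⟨b, hb, c, hc, h⟩ := Submodule.mem_sup.1
    ((V.isCompl_threadsCompl I).sup_eq_top ▸ Submodule.mem_top (x := (⟨y, hy⟩ : V.threads I)))
  refine ⟨c, hc, ?_⟩
  have : y t = (b : ∀ t, V.obj t) t + (c : ∀ t, V.obj t) t :=
    congrArg (fun z : V.threads I => (z : ∀ t, V.obj t) t) h.symm
  rw [this, add_sub_cancel_right]
  exact hb t ht

/-! ### The decomposition -/

variable (V) in
/-- The index set of the interval decomposition: a basis of `threadsCompl` for each interval. -/
abbrev SummandIndex : Type (max u w) :=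
  Σ I : OrderInterval R, Module.Basis.ofVectorSpaceIndex k (V.threadsCompl I)

/-- The generator of a summand. -/
noncomputable def generator (i : V.SummandIndex) : V.threads i.1 :=
  Module.Basis.ofVectorSpace k (V.threadsCompl i.1) i.2

variable (V) in
/-- The map from the interval module of a summand, at `t`. -/
noncomputable def summandMap (t : R) (i : V.SummandIndex) : intervalSpace k i.1 t →ₗ[k] V.obj t :=
  (LinearMap.toSpanSingleton k (V.obj t) ((generator i : ∀ t, V.obj t) t)).comp
    (intervalSpace k i.1 t).subtype

variable (V) in
/-- The map from the direct sum of interval modules, at `t`. -/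
noncomputable def decompositionMap [DecidableEq V.SummandIndex] (t : R) :
    (DirectSum V.SummandIndex fun i => intervalSpace k i.1 t) →ₗ[k] V.obj t :=
  DirectSum.toModule k _ _ (V.summandMap t)

theorem decompositionMap_lof [DecidableEq V.SummandIndex] (i : V.SummandIndex)
    (c : intervalSpace k i.1 t) :
    V.decompositionMap t (DirectSum.lof k _ (fun i => intervalSpace k i.1 t) i c) =
      (c : k) • (generator i : ∀ t, V.obj t) t := by
  rw [decompositionMap, DirectSum.toModule_lof]
  rfl

/-- Independence within a single interval: evaluation at `t` is injective on `threadsCompl` modulo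
`vMinus`. -/
theorem coeff_eq_zero_of_sum_mem_vMinus (hV : V.DCCImages) (ht : t ∈ I.carrier)
    {T : Finset (Module.Basis.ofVectorSpaceIndex k (V.threadsCompl I))}
    {c : Module.Basis.ofVectorSpaceIndex k (V.threadsCompl I) → k}
    (h : ∑ j ∈ T, c j • (generator (⟨I, j⟩ : V.SummandIndex) : ∀ t, V.obj t) t ∈ V.vMinus I t) :
    ∀ j ∈ T, c j = 0 := by
  let b := Module.Basis.ofVectorSpace k (V.threadsCompl I)
  have hc : ∑ j ∈ T, c j • b j = 0 := by
    refine Subtype.ext (eq_zero_of_mem_threadsCompl hV ht (SetLike.coe_mem _) ?_)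
    convert h using 1
    simp only [Submodule.coe_sum, Finset.sum_apply]
    rfl
  exact linearIndependent_iff'.1 b.linearIndependent T c hc

theorem coeff_eq_zero_of_sum_eq_zero (hV : V.DCCImages) {F : Finset V.SummandIndex}
    (hF : ∀ i ∈ F, t ∈ i.1.carrier) {c : V.SummandIndex → k}
    (h : ∑ i ∈ F, c i • (generator i : ∀ t, V.obj t) t = 0) : ∀ i ∈ F, c i = 0 := by
  classical
  by_contra! hne
  obtain ⟨i₀, hi₀, hci₀⟩ := hne
  set g : V.SummandIndex → V.obj t := fun i => c i • (generator i : ∀ t, V.obj t) t with hg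
  -- Zero terms are dropped so that the last interval occurring carries a nonzero coefficient.
  let G := F.filter fun i => c i ≠ 0
  have hG : ∑ i ∈ G, g i = 0 := by
    rw [← h]
    refine Finset.sum_filter_of_ne fun i _ hi hci => hi ?_
    rw [hg]
    simp [hci]
  obtain ⟨⟨I, j⟩, hj, hmax⟩ := G.exists_max_image (fun i => i.1.position)
    ⟨i₀, Finset.mem_filter.2 ⟨hi₀, hci₀⟩⟩
  have htG : ∀ i ∈ G, t ∈ i.1.carrier := fun i hi => hF i (Finset.mem_filter.1 hi).1
  have htI : t ∈ I.carrier := htG _ hj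
  have key : ∑ i ∈ G with i.1 = I, g i ∈ V.vMinus I t :=
    sum_mem_vMinus_of_sum_eq_zero htG
      (fun i hi => Submodule.smul_mem _ _ ((generator i).2.1 t (htG i hi))) hG htI hmax
  let T := G.preimage (Sigma.mk I) sigma_mk_injective.injOn
  have hT : G.filter (fun i => i.1 = I) = T.map ⟨Sigma.mk I, sigma_mk_injective⟩ := by
    ext ⟨J, i⟩
    simp only [Finset.mem_filter, Finset.mem_map, Function.Embedding.coeFn_mk, T,
      Finset.mem_preimage]
    constructor
    · rintro ⟨h, rfl⟩
      exact ⟨i, h, rfl⟩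
    · rintro ⟨j', h, h'⟩
      cases h'
      exact ⟨h, rfl⟩
  rw [hT, Finset.sum_map] at key
  exact (Finset.mem_filter.1 hj).2
    (coeff_eq_zero_of_sum_mem_vMinus hV htI key j (Finset.mem_preimage.2 hj))

theorem decompositionMap_injective [DecidableEq V.SummandIndex] (hV : V.DCCImages) (t : R) :
    Function.Injective (V.decompositionMap t) := by
  classical
  refine (injective_iff_map_eq_zero _).2 fun y hy => ?_
  have hzero : ∀ i ∈ y.support, (y i : k) = 0 := by
    refine coeff_eq_zero_of_sum_eq_zero (t := t) (c := fun i => (y i : k)) hV (fun i hi => ?_) ?_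
    · by_contra ht
      exact DFinsupp.mem_support_iff.1 hi (Subtype.ext (intervalSpace_eq_zero i.1 ht (y i)))
    · rw [← hy]
      conv_rhs => rw [← DirectSum.sum_support_of y, map_sum]
      exact Finset.sum_congr rfl fun i _ => (decompositionMap_lof i (y i)).symm
  refine DFinsupp.support_eq_empty.1 (Finset.eq_empty_of_forall_notMem fun i hi => ?_)
  exact DFinsupp.mem_support_iff.1 hi (Subtype.ext (hzero i hi))

theorem decompositionMap_surjective [DecidableEq V.SummandIndex]
    (hR : ∀ I : OrderInterval R, I.LeftSeparable) (hIm : V.DCCImages) (hKer : V.DCCSufficientBoundedKernels) (t : R) :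
    Function.Surjective (V.decompositionMap t) := by
  classical
  rw [← LinearMap.range_eq_top]
  refine eq_top_of_forall_vPlus_le hIm hKer fun I ht x hx => ?_
  obtain ⟨c, hc, hxc⟩ := exists_mem_threadsCompl hIm (hR I) ht hx
  refine Submodule.mem_sup.2 ⟨_, hxc, _, ?_, sub_add_cancel _ _⟩
  let b := Module.Basis.ofVectorSpace k (V.threadsCompl I)
  let ev : V.threadsCompl I →ₗ[k] V.obj t :=
    LinearMap.proj t ∘ₗ (V.threads I).subtype ∘ₗ (V.threadsCompl I).subtype
  -- It suffices to reach the values at `t` of the basis threads, which are the images of `1` in the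
  -- summands of `I`.
  have hle : (⊤ : Submodule k (V.threadsCompl I)) ≤
      (LinearMap.range (V.decompositionMap t)).comap ev := by
    rw [← b.span_eq, Submodule.span_le]
    rintro _ ⟨j, rfl⟩
    have h1 : (1 : k) ∈ intervalSpace k I t := by simp [intervalSpace, ht]
    refine ⟨DirectSum.lof k _ _ (⟨I, j⟩ : V.SummandIndex) ⟨1, h1⟩, ?_⟩
    rw [decompositionMap_lof]
    exact one_smul k _
  exact hle (Submodule.mem_top (x := ⟨c, hc⟩))

theorem decompositionMap_comm [DecidableEq V.SummandIndex] {s t : R} (h : s ≤ t)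
    (y : (directSum fun i : V.SummandIndex => intervalModule k i.1).obj s) :
    V.decompositionMap t ((directSum fun i : V.SummandIndex =>
      intervalModule k i.1).structureMap h y) = V.structureMap h (V.decompositionMap s y) := by
  classical
  suffices H : V.decompositionMap t ∘ₗ
      DFinsupp.mapRange.linearMap (fun i : V.SummandIndex => intervalMap k i.1 s t) =
      V.structureMap h ∘ₗ V.decompositionMap s from LinearMap.congr_fun H y
  refine DirectSum.linearMap_ext k fun i => LinearMap.ext fun c => ?_
  have h1 : DFinsupp.mapRange.linearMap (fun i : V.SummandIndex => intervalMap k i.1 s t)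
      (DirectSum.lof k V.SummandIndex (fun i => intervalSpace k i.1 s) i c) =
      DirectSum.lof k V.SummandIndex (fun i => intervalSpace k i.1 t) i
        (intervalMap k i.1 s t c) :=
    DFinsupp.mapRange_single (hf := fun i => map_zero (intervalMap k i.1 s t))
  simp only [LinearMap.comp_apply]
  rw [h1, decompositionMap_lof, decompositionMap_lof, map_smul, coe_intervalMap]
  by_cases hs : s ∈ i.1.carrier
  · rw [structureMap_thread (generator i).2 hs h]
    split_ifs with ht
    · rfl
    · rw [(generator i).2.2.1 t ht, smul_zero, smul_zero]
  · simp [intervalSpace_eq_zero i.1 hs c]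

end PersistenceModule

theorem theorem3p1 {k : Type v} [Field k] {R : Type u} [LinearOrder R]
    (hR : ∀ I : OrderInterval R, I.LeftSeparable)
    (V : PersistenceModule.{u, v, w} k R)
    (hIm : V.DCCImages) (hKer : V.DCCSufficientBoundedKernels) :
    ∃ (ι : Type (max u w)) (I : ι → OrderInterval R),
      Nonempty (V.PersistenceIso (PersistenceModule.directSum
        fun i => PersistenceModule.intervalModule k (I i))) := by
  classical
  let e := fun t => LinearEquiv.ofBijective (V.decompositionMap t)
    ⟨PersistenceModule.decompositionMap_injective hIm t,
      PersistenceModule.decompositionMap_surjective hR hIm hKer t⟩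
  refine ⟨V.SummandIndex, fun i => i.1, ⟨⟨fun t => (e t).symm, fun {s t} h x => ?_⟩⟩⟩
  refine (LinearEquiv.symm_apply_eq (e t)).2 ?_
  refine Eq.trans ?_ (PersistenceModule.decompositionMap_comm h ((e s).symm x)).symm
  exact congrArg (V.structureMap h) ((e s).apply_symm_apply x).symm
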